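/- Let $A$ be a square matrix with nonnegative real entries (for instance the adjacency matrix of a finite digraph with multiple arcs allowed), with rows and columns indexed by a finite set $V$. Its associated digraph $D$ has vertex set $V$ and an arc from $u$ to $v$ if and only if $A_{uv} \neq 0$. A digraph is irreducible if for every ordered pair $(s,t)$ of its vertices there is a walk (of length $\ge 0$) from $s$ to $t$; the irreducible components $D_1,\dots,D_t$ of $D$ are its maximal irreducible subdigraphs, and $A_i$ denotes the submatrix of $A$ with rows and columns in $V(D_i)$. A digraph is $p$-cyclic if its vertex set can be partitioned into classes $P_0,\dots,P_{p-1}$ such that every arc starting in $P_i$ ends in $P_{i+1}$ (indices modulo $p$); its period is the largest $p$ for which it is $p$-cyclic, and it is aperiodic if its period is $1$. Let $\rho$ be the spectral radius of $A$ and assume $\rho>0$. Suppose that $D_1$ is the unique irreducible component of $D$ such that the spectral radius of $A_1$ equals $\rho$, and that $D_1$ is aperiodic. Then there are a left $\rho$-eigenvector $v_L$ (a row vector) and a right $\rho$-eigenvector $v_R$ (a column vector) of $A$ with $v_L v_R = 1$. Moreover, for any left and right $\rho$-eigenvectors $v_L, v_R$ of $A$ normalized such that $v_L v_R = 1$, and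 for each complex row vector $w_L$ and complex column vector $w_R$, there exist $C>0$, $0<\epsilon<1$ and a function $p:\{0,1,2,\dots\}\to\mathbb{C}$ such that for all integers $n\ge 0$ $$ w_L A^n w_R = \left( (w_L v_R)(v_L w_R) + p(n) \right)\rho^n, \qquad |p(n)| < C(1-\epsilon)^n . $$ -/

import Mathlib

/-- The digraph associated with a square matrix: there is an arc from `u` to `v` exactly when the
entry in row `u` and column `v` is nonzero. If the matrix is the adjacency matrix of a digraph with
arc multiplicities, this is that digraph with the multiplicities forgotten. -/
def Matrix.assocDigraph {V : Type*} (A : Matrix V V ℝ) : Digraph V where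
  Adj u v := A u v ≠ 0

/-- There is a walk from `s` to `t`, of some length `m ≥ 0`. -/
def Digraph.HasWalk {V : Type*} (D : Digraph V) (s t : V) : Prop :=
  Relation.ReflTransGen D.Adj s t

/-- A digraph is irreducible if for every ordered pair `(s, t)` of vertices there is a walk from
`s` to `t`. -/
def Digraph.IsIrreducible {V : Type*} (D : Digraph V) : Prop :=
  ∀ s t : V, D.HasWalk s t

/-- The matrix induced on a vertex set `S`: rows and columns outside `S` are deleted. -/
def Matrix.inducedOn {V : Type*} (A : Matrix V V ℝ) (S : Finset V) : Matrix S S ℝ :=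
  A.submatrix (fun i => (i : V)) (fun j => (j : V))

/-- `S` is the vertex set of an irreducible component of the digraph of `A`: it is maximal among
the nonempty vertex sets that induce an irreducible digraph. -/
def Matrix.IsIrreducibleComponent {V : Type*} (A : Matrix V V ℝ) (S : Finset V) : Prop :=
  Maximal (fun T : Finset V => T.Nonempty ∧ (A.inducedOn T).assocDigraph.IsIrreducible) S

/-- A digraph is `p`-cyclic if its vertex set can be partitioned into classes `P_0, …, P_{p-1}`
such that each arc starting in `P_i` ends in `P_{i+1}`, indices modulo `p`. The map `c` sends a
vertex to the index of its class. -/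
def Digraph.IsPCyclic {V : Type*} (D : Digraph V) (p : ℕ) : Prop :=
  ∃ c : V → ZMod p, Function.Surjective c ∧ ∀ u v : V, D.Adj u v → c v = c u + 1

/-- `p` is the period of `D`: the largest positive `p` such that `D` is `p`-cyclic. -/
def Digraph.HasPeriod {V : Type*} (D : Digraph V) (p : ℕ) : Prop :=
  IsGreatest {q : ℕ | 0 < q ∧ D.IsPCyclic q} p

/-- A digraph is aperiodic if its period is `1`. -/
def Digraph.IsAperiodic {V : Type*} (D : Digraph V) : Prop :=
  D.HasPeriod 1

/-- The real matrix `A` regarded as a complex matrix. -/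
def Matrix.complexify {V : Type*} (A : Matrix V V ℝ) : Matrix V V ℂ :=
  A.map (fun x => (x : ℂ))

/-- The spectral radius: the largest modulus of a complex eigenvalue, as a real number. -/
noncomputable def Matrix.specRadius {V : Type*} [Fintype V] [DecidableEq V]
    (A : Matrix V V ℝ) : ℝ :=
  (spectralRadius ℂ A.complexify).toReal

/-- `v` is a right `μ`-eigenvector of `A`. -/
def Matrix.IsRightEigenvector {V : Type*} [Fintype V] (A : Matrix V V ℂ) (μ : ℂ) (v : V → ℂ) :
    Prop :=
  v ≠ 0 ∧ A.mulVec v = μ • v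

/-- `v` is a left `μ`-eigenvector of `A`. -/
def Matrix.IsLeftEigenvector {V : Type*} [Fintype V] (A : Matrix V V ℂ) (μ : ℂ) (v : V → ℂ) :
    Prop :=
  v ≠ 0 ∧ A.vecMul v = μ • v

namespace PerronFrobenius

open Filter Topology Matrix

/-! ### Spectral radius and growth of powers of complex matrices -/

section

variable {V : Type*} [Fintype V] [DecidableEq V]

/-! For an irreducible nonnegative matrix, the moduli of an eigenvector on the spectral circle form
a subinvariant vector, hence a positive Perron vector (`mulVec_eq_and_pos_of_smul_le`). The triangle
inequality is then an equality, so phases rotate by a fixed factor along every arc. Aperiodicity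
forces this factor to be 1 (`eq_specRadius_of_aperiodic`), and the eigenvector is unique up to
scaling.

For general `A`, an eigenvalue on the circle cannot come from any component other than the dominant
one (`eq_zero_of_eigenvector_on`). Eigenvectors on the circle are therefore determined by their
restriction to that component, where the irreducible theory applies: the only such eigenvalue is
`ρ`, and its eigenspace is a line. Conversely the Perron vector of the component extends to `A`. The
left and right extensions overlap only on the component, where both are positive, so they can be
normalized.

Subtracting the rank-one matrix `ρ • vecMulVec vR vL` thus leaves spectral radius less than `ρ`
(`spectralRadius_deflation_lt`), and Gelfand's formula bounds the remainder. -/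

theorem mem_spectrum_iff (B : Matrix V V ℂ) (z : ℂ) :
    z ∈ spectrum ℂ B ↔ ∃ x : V → ℂ, x ≠ 0 ∧ B *ᵥ x = z • x := by
  rw [spectrum.mem_iff, Matrix.isUnit_iff_isUnit_det, isUnit_iff_ne_zero, not_not,
    ← Matrix.exists_mulVec_eq_zero_iff]
  refine exists_congr fun x => and_congr_right fun _ => ?_
  rw [Matrix.sub_mulVec, sub_eq_zero, Algebra.algebraMap_eq_smul_one, Matrix.smul_mulVec,
    Matrix.one_mulVec, eq_comm]

open scoped Matrix.Norms.Operator in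
theorem spectralRadius_ne_top (B : Matrix V V ℂ) : spectralRadius ℂ B ≠ ⊤ := by
  have h := spectrum.spectralRadius_le_pow_nnnorm_pow_one_div ℂ B 0
  refine ne_top_of_le_ne_top ?_ h
  simp [ENNReal.mul_eq_top]

theorem norm_le_toReal_spectralRadius {B : Matrix V V ℂ} {z : ℂ} {x : V → ℂ} (hx : x ≠ 0)
    (h : B *ᵥ x = z • x) : ‖z‖ ≤ (spectralRadius ℂ B).toReal := by
  have hz : z ∈ spectrum ℂ B := (mem_spectrum_iff B z).2 ⟨x, hx, h⟩
  have h1 : (‖z‖₊ : ENNReal) ≤ spectralRadius ℂ B :=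
    le_iSup₂ (f := fun k (_ : k ∈ spectrum ℂ B) => (‖k‖₊ : ENNReal)) z hz
  simpa using ENNReal.toReal_mono (spectralRadius_ne_top B) h1

open scoped Matrix.Norms.Operator in
theorem exists_eigenvector_norm_eq [Nonempty V] (B : Matrix V V ℂ) :
    ∃ (z : ℂ) (x : V → ℂ), x ≠ 0 ∧ B *ᵥ x = z • x ∧ ‖z‖ = (spectralRadius ℂ B).toReal := by
  obtain ⟨z, hz, h⟩ := spectrum.exists_nnnorm_eq_spectralRadius B
  obtain ⟨x, hx, hxz⟩ := (mem_spectrum_iff B z).1 hz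
  exact ⟨z, x, hx, hxz, by rw [← h]; simp⟩

theorem toReal_spectralRadius_lt {B : Matrix V V ℂ} {r : ℝ} (hr : 0 < r)
    (h : ∀ (z : ℂ) (x : V → ℂ), x ≠ 0 → B *ᵥ x = z • x → ‖z‖ < r) :
    (spectralRadius ℂ B).toReal < r := by
  cases isEmpty_or_nonempty V
  · have : spectralRadius ℂ B = 0 := by
      rw [Subsingleton.elim B 0]
      simp [spectralRadius]
    simpa [this] using hr
  · obtain ⟨z, x, hx, hxz, hz⟩ := exists_eigenvector_norm_eq B
    exact hz ▸ h z x hx hxz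

open scoped Matrix.Norms.Operator in
/-- A consequence of Gelfand's formula. -/
theorem exists_norm_dotProduct_pow_mulVec_lt {B : Matrix V V ℂ} {r : ℝ}
    (hr : (spectralRadius ℂ B).toReal < r) (w x : V → ℂ) :
    ∃ C : ℝ, 0 < C ∧ ∀ n : ℕ, ‖w ⬝ᵥ (B ^ n) *ᵥ x‖ < C * r ^ n := by
  have hr0 : 0 < r := lt_of_le_of_lt ENNReal.toReal_nonneg hr
  have hlt : spectralRadius ℂ B < ENNReal.ofReal r :=
    (ENNReal.lt_ofReal_iff_toReal_lt (spectralRadius_ne_top B)).2 hr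
  have hev : ∀ᶠ n : ℕ in atTop, ‖B ^ n‖ / r ^ n ≤ 1 := by
    filter_upwards [(spectrum.pow_norm_pow_one_div_tendsto_nhds_spectralRadius B).eventually
      (gt_mem_nhds hlt), eventually_gt_atTop 0] with n hn hn0
    rw [div_le_one (by positivity)]
    have h1 : ‖B ^ n‖ ^ (1 / n : ℝ) < r := (ENNReal.ofReal_lt_ofReal_iff hr0).1 hn
    have h2 := pow_le_pow_left₀ (by positivity) h1.le n
    rwa [one_div, Real.rpow_inv_natCast_pow (norm_nonneg _) hn0.ne'] at h2
  obtain ⟨K, hK⟩ := (isBoundedUnder_of_eventually_le hev).bddAbove_range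
  have hK' : ∀ n : ℕ, ‖B ^ n‖ ≤ K * r ^ n := fun n => by
    rw [← div_le_iff₀ (by positivity)]
    exact hK ⟨n, rfl⟩
  have hK0 : 0 ≤ K := by simpa using (norm_nonneg _).trans (hK' 0)
  -- The summand 1 makes the constant positive and the bound strict even if `w` or `x` is zero.
  refine ⟨(∑ i, ‖w i‖) * (K * ‖x‖) + 1, by positivity, fun n => ?_⟩
  have h1 : ‖w ⬝ᵥ (B ^ n) *ᵥ x‖ ≤ ∑ i, ‖w i‖ * ‖(B ^ n) *ᵥ x‖ := by
    refine (norm_sum_le _ _).trans (Finset.sum_le_sum fun i _ => ?_)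
    rw [norm_mul]
    exact mul_le_mul_of_nonneg_left (norm_le_pi_norm _ i) (norm_nonneg _)
  rw [← Finset.sum_mul] at h1
  have h2 : ‖(B ^ n) *ᵥ x‖ ≤ K * r ^ n * ‖x‖ :=
    (Matrix.linfty_opNorm_mulVec _ _).trans
      (mul_le_mul_of_nonneg_right (hK' n) (norm_nonneg _))
  have h3 := mul_le_mul_of_nonneg_left h2 (Finset.sum_nonneg fun i (_ : i ∈ Finset.univ) =>
    norm_nonneg (w i))
  have h4 : 0 < r ^ n := by positivity
  linarith

theorem spectralRadius_transpose (B : Matrix V V ℂ) :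
    spectralRadius ℂ Bᵀ = spectralRadius ℂ B := by
  have : spectrum ℂ Bᵀ = spectrum ℂ B := by
    ext z
    rw [spectrum.mem_iff, spectrum.mem_iff, ← Matrix.isUnit_transpose (A := algebraMap _ _ z - B),
      Matrix.transpose_sub, Algebra.algebraMap_eq_smul_one, Matrix.transpose_smul,
      Matrix.transpose_one]
  simp only [spectralRadius, this]

theorem specRadius_transpose (A : Matrix V V ℝ) : Aᵀ.specRadius = A.specRadius :=
  congrArg ENNReal.toReal (spectralRadius_transpose A.complexify)

/-! ### Nonnegative matrices and subinvariant vectors -/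

omit [DecidableEq V] in
theorem complexify_mulVec (A : Matrix V V ℝ) (y : V → ℝ) (i : V) :
    (A.complexify *ᵥ fun j => (y j : ℂ)) i = ((A *ᵥ y) i : ℝ) := by
  simp [Matrix.mulVec, dotProduct, Matrix.complexify]

theorem complexify_pow (A : Matrix V V ℝ) (n : ℕ) : (A ^ n).complexify = A.complexify ^ n :=
  Matrix.map_pow A Complex.ofRealHom n

omit [DecidableEq V] in
theorem mulVec_mono {A : Matrix V V ℝ} (hA : ∀ i j, 0 ≤ A i j) {x y : V → ℝ} (h : x ≤ y) :
    A *ᵥ x ≤ A *ᵥ y := fun i =>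
  Finset.sum_le_sum fun j _ => mul_le_mul_of_nonneg_left (h j) (hA i j)

/-- A nonnegative matrix with a nonzero subinvariant vector for `r` has spectral radius at least
`r`. -/
theorem le_specRadius_of_smul_le_mulVec {A : Matrix V V ℝ} (hA : ∀ i j, 0 ≤ A i j) {r : ℝ}
    {y : V → ℝ} (hr : 0 ≤ r) (hy : 0 ≤ y) (hy0 : y ≠ 0) (h : r • y ≤ A *ᵥ y) :
    r ≤ A.specRadius := by
  by_contra! hlt
  obtain ⟨s, hs, hsr⟩ := exists_between hlt
  have hs0 : 0 < s := lt_of_le_of_lt ENNReal.toReal_nonneg hs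
  -- Iterating subinvariance gives growth of order `r ^ n`, against Gelfand's bound of order `s ^ n`
  -- with `s < r`.
  have hpow : ∀ n : ℕ, r ^ n • y ≤ (A ^ n) *ᵥ y := by
    intro n
    induction n with
    | zero => simp
    | succ n ih =>
      have h1 := mulVec_mono hA ih
      rw [Matrix.mulVec_mulVec, ← pow_succ', Matrix.mulVec_smul] at h1
      refine le_trans ?_ h1
      rw [pow_succ, mul_smul]
      exact smul_le_smul_of_nonneg_left h (by positivity)
  obtain ⟨i, hi⟩ := Function.ne_iff.1 hy0
  have hyi : 0 < y i := lt_of_le_of_ne (hy i) (Ne.symm hi)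
  obtain ⟨C, hC, hb⟩ := exists_norm_dotProduct_pow_mulVec_lt hs (Pi.single i 1)
    (fun j => (y j : ℂ))
  have hb' : ∀ n : ℕ, (r / s) ^ n * y i ≤ C := by
    intro n
    have h1 := (hb n).le
    rw [← complexify_pow, single_one_dotProduct, complexify_mulVec, Complex.norm_real] at h1
    have h2 := (hpow n i).trans ((le_abs_self _).trans h1)
    rw [div_pow, div_mul_eq_mul_div, div_le_iff₀ (by positivity)]
    exact h2
  obtain ⟨n, hn⟩ := pow_unbounded_of_one_lt (C / y i) ((one_lt_div hs0).2 hsr)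
  exact absurd (hb' n) (not_le.2 ((div_lt_iff₀ hyi).1 hn))

-- The triangle inequality, row by row. This is how complex eigenvectors supply nonnegative
-- subinvariant vectors.
omit [DecidableEq V] in
theorem norm_smul_le_mulVec_norm {A : Matrix V V ℝ} (hA : ∀ i j, 0 ≤ A i j) {z : ℂ} {x : V → ℂ}
    (h : A.complexify *ᵥ x = z • x) :
    ‖z‖ • (fun j => ‖x j‖) ≤ A *ᵥ fun j => ‖x j‖ := by
  intro i
  have h1 : ‖z‖ * ‖x i‖ = ‖(A.complexify *ᵥ x) i‖ := by rw [h]; simp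
  simp only [Pi.smul_apply, smul_eq_mul, h1]
  refine (norm_sum_le _ _).trans (Finset.sum_le_sum fun j _ => ?_)
  simp [Matrix.complexify, abs_of_nonneg (hA i j)]

/-! ### Perron vectors of irreducible matrices -/

theorem pow_nonneg_apply {A : Matrix V V ℝ} (hA : ∀ i j, 0 ≤ A i j) (n : ℕ) (i j : V) :
    0 ≤ (A ^ n) i j := by
  induction n generalizing i j with
  | zero => rw [pow_zero, Matrix.one_apply]; split_ifs <;> norm_num
  | succ n ih =>
    rw [pow_succ, Matrix.mul_apply]
    exact Finset.sum_nonneg fun k _ => mul_nonneg (ih i k) (hA k j)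

omit [Fintype V] in
theorem one_add_nonneg {A : Matrix V V ℝ} (hA : ∀ i j, 0 ≤ A i j) (i j : V) :
    0 ≤ (1 + A) i j := by
  rw [Matrix.add_apply, Matrix.one_apply]
  have := hA i j
  split_ifs <;> linarith

/-- The identity summand lets a walk pause, so entries once positive stay positive and one exponent
can serve all pairs. -/
theorem one_add_pow_mono {A : Matrix V V ℝ} (hA : ∀ i j, 0 ≤ A i j) (i j : V) :
    Monotone fun n : ℕ => ((1 + A) ^ n) i j := by
  refine monotone_nat_of_le_succ fun n => ?_
  rw [pow_succ, mul_add, mul_one, Matrix.add_apply, Matrix.mul_apply, le_add_iff_nonneg_right]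
  exact Finset.sum_nonneg fun k _ =>
    mul_nonneg (pow_nonneg_apply (one_add_nonneg hA) n i k) (hA k j)

theorem exists_one_add_pow_apply_pos {A : Matrix V V ℝ} (hA : ∀ i j, 0 ≤ A i j) {i j : V}
    (h : A.assocDigraph.HasWalk i j) : ∃ n : ℕ, 0 < ((1 + A) ^ n) i j := by
  induction h with
  | refl => exact ⟨0, by simp⟩
  | @tail k l _ hkl ih =>
    obtain ⟨n, hn⟩ := ih
    refine ⟨n + 1, ?_⟩
    rw [pow_succ, Matrix.mul_apply]
    refine Finset.sum_pos' (fun m _ => mul_nonneg (pow_nonneg_apply (one_add_nonneg hA) n i m)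
      (one_add_nonneg hA m l)) ⟨k, Finset.mem_univ _, mul_pos hn ?_⟩
    have h1 : 0 < A k l := lt_of_le_of_ne (hA k l) (Ne.symm hkl)
    rw [Matrix.add_apply, Matrix.one_apply]
    split_ifs <;> linarith

/-- For an irreducible matrix some power of `1 + A` is positive. -/
theorem exists_one_add_pow_pos {A : Matrix V V ℝ} (hA : ∀ i j, 0 ≤ A i j)
    (hirr : A.assocDigraph.IsIrreducible) : ∃ n : ℕ, ∀ i j, 0 < ((1 + A) ^ n) i j := by
  choose k hk using fun i j => exists_one_add_pow_apply_pos hA (hirr i j)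
  refine ⟨∑ i, ∑ j, k i j, fun i j => (hk i j).trans_le (one_add_pow_mono hA i j ?_)⟩
  exact (Finset.single_le_sum (f := fun j => k i j) (fun _ _ => Nat.zero_le _)
    (Finset.mem_univ j)).trans (Finset.single_le_sum (f := fun i => ∑ j, k i j)
      (fun _ _ => Nat.zero_le _) (Finset.mem_univ i))

omit [DecidableEq V] in
theorem mulVec_pos {P : Matrix V V ℝ} (hP : ∀ i j, 0 < P i j) {y : V → ℝ} (hy : 0 ≤ y)
    (hy0 : y ≠ 0) (i : V) : 0 < (P *ᵥ y) i := by
  obtain ⟨j, hj⟩ := Function.ne_iff.1 hy0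
  exact Finset.sum_pos' (fun k _ => mul_nonneg (hP i k).le (hy k))
    ⟨j, Finset.mem_univ _, mul_pos (hP i j) (lt_of_le_of_ne (hy j) (Ne.symm hj))⟩

/-- A nonzero nonnegative subinvariant vector for the spectral radius of an irreducible matrix is
a positive eigenvector. -/
theorem mulVec_eq_and_pos_of_smul_le {A : Matrix V V ℝ} (hA : ∀ i j, 0 ≤ A i j)
    (hirr : A.assocDigraph.IsIrreducible) {y : V → ℝ} (hy : 0 ≤ y) (hy0 : y ≠ 0)
    (h : A.specRadius • y ≤ A *ᵥ y) : A *ᵥ y = A.specRadius • y ∧ ∀ i, 0 < y i := by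
  obtain ⟨N, hN⟩ := exists_one_add_pow_pos hA hirr
  have hr : 0 ≤ A.specRadius := ENNReal.toReal_nonneg
  set r := A.specRadius with hrdef
  obtain ⟨i₀, -⟩ := Function.ne_iff.1 hy0
  have : Nonempty V := ⟨i₀⟩
  have heq : A *ᵥ y = r • y := by
    -- A nonzero defect `A *ᵥ y - r • y` becomes strictly positive under `(1 + A) ^ N`, which
    -- commutes with `A`. Then `y'` is subinvariant for some `r + δ > r`, which is impossible.
    by_contra hne
    have hd0 : A *ᵥ y - r • y ≠ 0 := sub_ne_zero.2 hne
    have hpos := mulVec_pos hN (sub_nonneg.2 h) hd0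
    have hy' := mulVec_pos hN hy hy0
    set y' := (1 + A) ^ N *ᵥ y with hy'def
    have hcomm : (1 + A) ^ N *ᵥ (A *ᵥ y - r • y) = A *ᵥ y' - r • y' := by
      have hc : Commute ((1 + A) ^ N) A :=
        ((Commute.one_left A).add_left (Commute.refl A)).pow_left N
      rw [Matrix.mulVec_sub, Matrix.mulVec_mulVec, hc.eq, Matrix.mulVec_smul,
        ← Matrix.mulVec_mulVec]
    rw [hcomm] at hpos
    obtain ⟨i, hi⟩ := Finite.exists_min fun i => (A *ᵥ y' - r • y') i / y' i
    have hδ : 0 < (A *ᵥ y' - r • y') i / y' i := div_pos (hpos i) (hy' i)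
    set δ := (A *ᵥ y' - r • y') i / y' i
    have hle : (r + δ) • y' ≤ A *ᵥ y' := fun j => by
      have := (le_div_iff₀ (hy' j)).1 (hi j)
      simp only [Pi.sub_apply, Pi.smul_apply, smul_eq_mul] at this ⊢
      linarith
    have := le_specRadius_of_smul_le_mulVec hA (by linarith) (fun j => (hy' j).le)
      (Function.ne_iff.2 ⟨i₀, (hy' i₀).ne'⟩) hle
    linarith
  refine ⟨heq, fun i => ?_⟩
  -- For `n = N` the left side is positive, so its positive multiple `y` is too.
  have hpow : ∀ n : ℕ, (1 + A) ^ n *ᵥ y = (1 + r) ^ n • y := by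
    intro n
    induction n with
    | zero => simp
    | succ n ih =>
      rw [pow_succ, ← Matrix.mulVec_mulVec, Matrix.add_mulVec, Matrix.one_mulVec, heq,
        show y + r • y = (1 + r) • y by rw [add_smul, one_smul], Matrix.mulVec_smul, ih, smul_smul, pow_succ']
  have := mulVec_pos hN hy hy0 i
  rw [hpow, Pi.smul_apply, smul_eq_mul] at this
  exact (pos_iff_pos_of_mul_pos this).1 (by positivity)

theorem exists_pos_eigenvector [Nonempty V] {A : Matrix V V ℝ} (hA : ∀ i j, 0 ≤ A i j)
    (hirr : A.assocDigraph.IsIrreducible) :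
    ∃ y : V → ℝ, (∀ i, 0 < y i) ∧ A *ᵥ y = A.specRadius • y := by
  obtain ⟨z, x, hx, hxz, hz⟩ := exists_eigenvector_norm_eq A.complexify
  have h := norm_smul_le_mulVec_norm hA hxz
  have hn : (fun j => ‖x j‖) ≠ 0 := by
    obtain ⟨i, hi⟩ := Function.ne_iff.1 hx
    exact Function.ne_iff.2 ⟨i, norm_ne_zero_iff.2 hi⟩
  rw [hz] at h
  obtain ⟨h1, h2⟩ := mulVec_eq_and_pos_of_smul_le hA hirr (fun j => norm_nonneg (x j)) hn h
  exact ⟨_, h2, h1⟩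

/-! ### Eigenvalues on the spectral circle of an irreducible matrix -/

/-- The equality case of the triangle inequality for a finite sum. -/
theorem norm_mul_eq_of_norm_sum_eq {ι : Type*} {s : Finset ι} {f : ι → ℂ}
    (h : ‖∑ i ∈ s, f i‖ = ∑ i ∈ s, ‖f i‖) {i : ι} (hi : i ∈ s) :
    (‖f i‖ : ℂ) * ∑ j ∈ s, f j = (‖∑ j ∈ s, f j‖ : ℂ) * f i := by
  set S := ∑ j ∈ s, f j with hS
  have hre : ∀ w : ℂ, (star S * w).re ≤ ‖S‖ * ‖w‖ := fun w => by
    simpa using Complex.re_le_norm (star S * w)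
  -- Both sides equal `‖S‖ ^ 2`, so the termwise bounds `hre` are all equalities.
  have hsum : ∑ j ∈ s, (star S * f j).re = ∑ j ∈ s, ‖S‖ * ‖f j‖ := by
    rw [← Complex.re_sum, ← Finset.mul_sum, ← Finset.mul_sum, ← hS, ← h, mul_comm (star S),
      Complex.star_def, Complex.mul_conj, Complex.ofReal_re, Complex.normSq_eq_norm_sq, sq]
  have h1 : (star S * f i).re = ‖S‖ * ‖f i‖ :=
    (Finset.sum_eq_sum_iff_of_le fun j _ => hre (f j)).1 hsum i hi
  have h2 : star S * f i = (‖S‖ : ℂ) * ‖f i‖ := by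
    have h3 : (star S * f i).re = ‖star S * f i‖ := by rw [h1]; simp
    have h4 := Complex.re_eq_norm.1 h3
    have h5 := Complex.eq_re_of_ofReal_le h4
    rw [h1] at h5
    simpa using h5
  by_cases hS0 : S = 0
  · simp [hS0]
  · have hn : (‖S‖ : ℂ) ≠ 0 := by simpa using hS0
    refine mul_left_cancel₀ hn ?_
    calc (‖S‖ : ℂ) * (‖f i‖ * S) = (star S * f i) * S := by rw [h2]; ring
      _ = (S * star S) * f i := by ring
      _ = _ := by
        rw [Complex.star_def, Complex.mul_conj, Complex.normSq_eq_norm_sq]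
        push_cast
        ring

/-- The moduli form a Perron vector, so the triangle inequality is sharp in every row: along an arc
from `i` to `j`, the entries `x j` and `z * x i` have the same phase. -/
theorem arg_propagate {A : Matrix V V ℝ} (hA : ∀ i j, 0 ≤ A i j)
    (hirr : A.assocDigraph.IsIrreducible) {z : ℂ} {x : V → ℂ} (hx : x ≠ 0)
    (h : A.complexify *ᵥ x = z • x) (hz : ‖z‖ = A.specRadius) :
    (∀ i, x i ≠ 0) ∧ ∀ i j, A i j ≠ 0 → (‖x j‖ : ℂ) * (z * x i) = ‖z‖ * ‖x i‖ * x j := by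
  have h1 := norm_smul_le_mulVec_norm hA h
  have hn : (fun j => ‖x j‖) ≠ 0 := by
    obtain ⟨i, hi⟩ := Function.ne_iff.1 hx
    exact Function.ne_iff.2 ⟨i, norm_ne_zero_iff.2 hi⟩
  rw [hz] at h1
  obtain ⟨h2, h3⟩ := mulVec_eq_and_pos_of_smul_le hA hirr (fun j => norm_nonneg (x j)) hn h1
  refine ⟨fun i => norm_pos_iff.1 (h3 i), fun i j hij => ?_⟩
  have hS : ∑ j, A.complexify i j * x j = z * x i := congrFun h i
  have hT : ∑ j, A i j * ‖x j‖ = A.specRadius * ‖x i‖ := congrFun h2 i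
  have hnorm : ∀ j, ‖A.complexify i j * x j‖ = A i j * ‖x j‖ := fun j => by
    simp [Matrix.complexify, abs_of_nonneg (hA i j)]
  have h5 := norm_mul_eq_of_norm_sum_eq (s := Finset.univ) (f := fun j => A.complexify i j * x j)
    (by simp_rw [hnorm]; rw [hS, hT, norm_mul, hz]) (Finset.mem_univ j)
  simp only [hnorm] at h5
  rw [hS, norm_mul] at h5
  have h6 : (A i j : ℂ) ≠ 0 := by exact_mod_cast hij
  refine mul_left_cancel₀ h6 ?_
  simp only [Matrix.complexify, Matrix.map_apply] at h5
  push_cast at h5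
  linear_combination h5

/-- The spectral radius of an irreducible aperiodic nonnegative matrix is its only eigenvalue on the
spectral circle. -/
theorem eq_specRadius_of_aperiodic {A : Matrix V V ℝ} (hA : ∀ i j, 0 ≤ A i j)
    (hirr : A.assocDigraph.IsIrreducible) (haper : A.assocDigraph.IsAperiodic)
    (hpos : 0 < A.specRadius) {z : ℂ} {x : V → ℂ} (hx : x ≠ 0)
    (h : A.complexify *ᵥ x = z • x) (hz : ‖z‖ = A.specRadius) : z = A.specRadius := by
  obtain ⟨hx0, hprop⟩ := arg_propagate hA hirr hx h hz
  obtain ⟨v₀, -⟩ := Function.ne_iff.1 hx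
  have hzn : (‖z‖ : ℂ) ≠ 0 := by rw [hz]; exact_mod_cast hpos.ne'
  -- `ω` and `θ` are the phases of `z` and `x`; each arc multiplies `θ` by `ω`.
  set ω : ℂ := z / ‖z‖ with hω
  set θ : V → ℂ := fun v => x v / ‖x v‖ with hθ
  have hxn : ∀ v, (‖x v‖ : ℂ) ≠ 0 := fun v => by simpa using hx0 v
  have hz0 : z ≠ 0 := fun h0 => hzn (by simp [h0])
  have hω0 : ω ≠ 0 := div_ne_zero hz0 hzn
  have hθ0 : ∀ v, θ v ≠ 0 := fun v => div_ne_zero (hx0 v) (hxn v)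
  have hstep : ∀ i j, A i j ≠ 0 → θ j = ω * θ i := fun i j hij => by
    have h1 := hprop i j hij
    have h2 := hxn i
    have h3 := hxn j
    simp only [hθ, hω]
    field_simp
    linear_combination -h1
  have hpath : ∀ i j, A.assocDigraph.HasWalk i j → ∃ m : ℕ, θ j = ω ^ m * θ i := by
    intro i j hij
    induction hij with
    | refl => exact ⟨0, by simp⟩
    | @tail k l _ hkl ih =>
      obtain ⟨m, hm⟩ := ih
      exact ⟨m + 1, by rw [hstep k l hkl, hm]; ring⟩
  choose m hm using fun v => hpath v₀ v (hirr v₀ v)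
  have hout : ∀ i, ∃ j, A i j ≠ 0 := fun i => by
    by_contra! hc
    have h1 : ∑ j, A.complexify i j * x j = z * x i := congrFun h i
    rw [Finset.sum_eq_zero fun j _ => by simp [Matrix.complexify, hc j]] at h1
    exact mul_ne_zero hz0 (hx0 i) h1.symm
  have harc : ∀ i j, A i j ≠ 0 → ω ^ m j = ω ^ (m i + 1) := fun i j hij => by
    have h1 := hstep i j hij
    rw [hm i, hm j] at h1
    refine mul_right_cancel₀ (hθ0 v₀) ?_
    rw [h1]; ring
  -- A closed walk through `v₀` of length `k + 1` gives `ω ^ (k + 1) = 1`.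
  have hfin : 0 < orderOf ω := by
    obtain ⟨w, hw⟩ := hout v₀
    obtain ⟨k, hk⟩ := hpath w v₀ (hirr w v₀)
    rw [orderOf_pos_iff, isOfFinOrder_iff_pow_eq_one]
    refine ⟨k + 1, Nat.succ_pos k, mul_right_cancel₀ (hθ0 v₀) ?_⟩
    rw [hstep v₀ w hw] at hk
    rw [one_mul]
    conv_rhs => rw [hk]
    ring
  set p := orderOf ω with hp
  have : NeZero p := ⟨hfin.ne'⟩
  -- The class of `v` is the exponent `m v` modulo the order of `ω`. All classes occur because every
  -- vertex has an outgoing arc, which raises the class by one.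
  have hcyc : A.assocDigraph.IsPCyclic p := by
    have hc : ∀ i j, A.assocDigraph.Adj i j → ((m j : ℕ) : ZMod p) = (m i : ZMod p) + 1 := by
      intro i j hij
      have h1 := (orderOf_pos_iff.1 hfin).pow_eq_pow_iff_modEq.1 (harc i j hij)
      have h2 := (ZMod.natCast_eq_natCast_iff (m j) (m i + 1) p).2 h1
      rw [h2]; push_cast; rfl
    refine ⟨fun v => (m v : ZMod p), ?_, hc⟩
    have hsurj : ∀ k : ℕ, ∃ v, (m v : ZMod p) = m v₀ + k := by
      intro k
      induction k with
      | zero => exact ⟨v₀, by simp⟩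
      | succ k ih =>
        obtain ⟨v, hv⟩ := ih
        obtain ⟨w, hw⟩ := hout v
        exact ⟨w, by rw [hc v w hw, hv]; push_cast; ring⟩
    intro a
    obtain ⟨v, hv⟩ := hsurj (a - m v₀).val
    exact ⟨v, by simpa using hv⟩
  have hp1 : p = 1 := le_antisymm (haper.2 ⟨hfin, hcyc⟩) hfin
  have hω1 : ω = 1 := orderOf_eq_one_iff.1 hp1
  rw [hω, div_eq_one_iff_eq hzn] at hω1
  rw [hω1, hz]

/-- Eigenvectors for the spectral radius of an irreducible matrix are unique up to scaling. -/
theorem eq_smul_of_irreducible {A : Matrix V V ℝ} (hA : ∀ i j, 0 ≤ A i j)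
    (hirr : A.assocDigraph.IsIrreducible) {x u : V → ℂ} (hu : ∀ i, u i ≠ 0)
    (hux : A.complexify *ᵥ u = (A.specRadius : ℂ) • u)
    (h : A.complexify *ᵥ x = (A.specRadius : ℂ) • x) : ∃ c : ℂ, x = c • u := by
  cases isEmpty_or_nonempty V
  · exact ⟨0, Subsingleton.elim _ _⟩
  obtain ⟨v⟩ := ‹Nonempty V›
  refine ⟨x v / u v, ?_⟩
  by_contra hne
  -- This difference vanishes at `v`, whereas an eigenvector on the spectral circle has no zero
  -- entry.
  have h1 : x - (x v / u v) • u ≠ 0 := sub_ne_zero.2 hne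
  have h2 := (arg_propagate hA hirr h1 (z := A.specRadius) (by
    rw [Matrix.mulVec_sub, Matrix.mulVec_smul, h, hux, smul_sub, smul_comm]) (by
    rw [Complex.norm_real, Real.norm_of_nonneg (show 0 ≤ A.specRadius from ENNReal.toReal_nonneg)])).1 v
  apply h2
  simp [hu v]

end

/-! ### Irreducible components as strongly connected classes -/

variable {V : Type*}

theorem hasWalk_transpose (A : Matrix V V ℝ) (s t : V) :
    Aᵀ.assocDigraph.HasWalk s t ↔ A.assocDigraph.HasWalk t s :=
  Relation.reflTransGen_swap (r := A.assocDigraph.Adj)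

theorem isIrreducible_transpose (A : Matrix V V ℝ) :
    Aᵀ.assocDigraph.IsIrreducible ↔ A.assocDigraph.IsIrreducible :=
  ⟨fun h s t => (hasWalk_transpose A t s).1 (h t s),
    fun h s t => (hasWalk_transpose A s t).2 (h t s)⟩

theorem isIrreducibleComponent_transpose (A : Matrix V V ℝ) (S : Finset V) :
    Aᵀ.IsIrreducibleComponent S ↔ A.IsIrreducibleComponent S := by
  have : (fun T : Finset V => T.Nonempty ∧ (Aᵀ.inducedOn T).assocDigraph.IsIrreducible) =
      fun T : Finset V => T.Nonempty ∧ (A.inducedOn T).assocDigraph.IsIrreducible :=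
    funext fun T => propext (and_congr_right fun _ => isIrreducible_transpose (A.inducedOn T))
  rw [Matrix.IsIrreducibleComponent, this, Matrix.IsIrreducibleComponent]

theorem hasWalk_of_inducedOn {A : Matrix V V ℝ} {S : Finset V} {s t : S}
    (h : (A.inducedOn S).assocDigraph.HasWalk s t) : A.assocDigraph.HasWalk s t :=
  Relation.ReflTransGen.lift (fun i : S => (i : V)) (fun _ _ h => h) s t h

variable [Fintype V]

open scoped Classical in
/-- The strongly connected class of a vertex in the digraph of `A`. -/
noncomputable def strongClass (A : Matrix V V ℝ) (v : V) : Finset V :=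
  Finset.univ.filter fun w => A.assocDigraph.HasWalk v w ∧ A.assocDigraph.HasWalk w v

theorem mem_strongClass {A : Matrix V V ℝ} {v w : V} :
    w ∈ strongClass A v ↔ A.assocDigraph.HasWalk v w ∧ A.assocDigraph.HasWalk w v := by
  simp [strongClass]

theorem self_mem_strongClass (A : Matrix V V ℝ) (v : V) : v ∈ strongClass A v :=
  mem_strongClass.2 ⟨.refl, .refl⟩

theorem isIrreducible_strongClass (A : Matrix V V ℝ) (v : V) :
    (A.inducedOn (strongClass A v)).assocDigraph.IsIrreducible := by
  rintro ⟨s, hs⟩ ⟨t, ht⟩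
  have hst : A.assocDigraph.HasWalk s t :=
    (mem_strongClass.1 hs).2.trans (mem_strongClass.1 ht).1
  suffices ∀ h : s ∈ strongClass A v,
      (A.inducedOn (strongClass A v)).assocDigraph.HasWalk ⟨s, h⟩ ⟨t, ht⟩ from this hs
  clear hs
  induction hst using Relation.ReflTransGen.head_induction_on with
  | refl => exact fun _ => .refl
  | @head a c hac hct ih =>
    intro ha
    have hc : c ∈ strongClass A v := mem_strongClass.2
      ⟨(mem_strongClass.1 ha).1.tail hac, hct.trans (mem_strongClass.1 ht).2⟩
    exact Relation.ReflTransGen.head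
      (show (A.inducedOn (strongClass A v)).assocDigraph.Adj ⟨a, ha⟩ ⟨c, hc⟩ from hac) (ih hc)

theorem subset_strongClass {A : Matrix V V ℝ} {S : Finset V} {s : V}
    (h : (A.inducedOn S).assocDigraph.IsIrreducible) (hs : s ∈ S) : S ⊆ strongClass A s :=
  fun t ht => mem_strongClass.2
    ⟨hasWalk_of_inducedOn (h ⟨s, hs⟩ ⟨t, ht⟩), hasWalk_of_inducedOn (h ⟨t, ht⟩ ⟨s, hs⟩)⟩

theorem isIrreducibleComponent_strongClass (A : Matrix V V ℝ) (v : V) :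
    A.IsIrreducibleComponent (strongClass A v) :=
  ⟨⟨⟨v, self_mem_strongClass A v⟩, isIrreducible_strongClass A v⟩, fun _ hT hle =>
    subset_strongClass hT.2 (hle (self_mem_strongClass A v))⟩

theorem eq_strongClass {A : Matrix V V ℝ} {S : Finset V} (h : A.IsIrreducibleComponent S) {s : V}
    (hs : s ∈ S) : S = strongClass A s :=
  have hsub := subset_strongClass h.prop.2 hs
  hsub.antisymm (h.2 (isIrreducibleComponent_strongClass A s).prop hsub)

/-! ### Restriction to induced submatrices -/

theorem mulVec_eq_submatrix_mulVec {R : Type*} [CommSemiring R] (B : Matrix V V R) {C : Finset V}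
    {x : V → R} (i : C) (h : ∀ j ∉ C, B i j * x j = 0) :
    (B *ᵥ x) i = (B.submatrix (fun i : C => (i : V)) (fun j : C => (j : V)) *ᵥ
      fun j : C => x j) i := by
  have h1 : ∑ j ∈ C, B i j * x j = ∑ j, B i j * x j :=
    Finset.sum_subset (Finset.subset_univ C) fun j _ hj => h j hj
  exact h1.symm.trans (Finset.sum_coe_sort C fun j => B i j * x j).symm

variable [DecidableEq V]

theorem specRadius_inducedOn_le {A : Matrix V V ℝ} (hA : ∀ i j, 0 ≤ A i j) {C : Finset V}
    (hC : C.Nonempty) : (A.inducedOn C).specRadius ≤ A.specRadius := by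
  have : Nonempty C := hC.to_subtype
  obtain ⟨z, x, hx, hxz, hz⟩ := exists_eigenvector_norm_eq (A.inducedOn C).complexify
  have h := norm_smul_le_mulVec_norm (A := A.inducedOn C) (fun i j => hA i j) hxz
  rw [hz] at h
  set r := (spectralRadius ℂ (A.inducedOn C).complexify).toReal
  -- Extended by zero, the moduli stay subinvariant for the whole matrix, since the added entries
  -- are nonnegative.
  set Y : V → ℝ := fun i => if h : i ∈ C then ‖x ⟨i, h⟩‖ else 0 with hY
  have hYC : (fun j : C => Y j) = fun j => ‖x j‖ := funext fun j => by simp [hY]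
  have hY0 : 0 ≤ Y := fun i => by
    simp only [hY]; split_ifs <;> simp
  refine le_specRadius_of_smul_le_mulVec hA (r := r) (y := Y) ENNReal.toReal_nonneg hY0 ?_ ?_
  · obtain ⟨i, hi⟩ := Function.ne_iff.1 hx
    exact Function.ne_iff.2 ⟨i, by simpa [hY] using hi⟩
  · intro i
    by_cases hi : i ∈ C
    · rw [mulVec_eq_submatrix_mulVec A ⟨i, hi⟩ fun j hj => by simp [hY, hj], hYC]
      simpa [hY, hi] using! h ⟨i, hi⟩
    · rw [Pi.smul_apply, smul_eq_mul, show Y i = 0 by simp [hY, hi], mul_zero]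
      exact Finset.sum_nonneg fun j _ => mul_nonneg (hA i j) (hY0 j)

/-! ### Reduction to the dominant component -/

/-- `S` is the only irreducible component of the nonnegative matrix `A` whose spectral radius is
the spectral radius `ρ > 0` of `A`. -/
structure IsDominantComponent (A : Matrix V V ℝ) (ρ : ℝ) (S : Finset V) : Prop where
  nonneg : ∀ i j, 0 ≤ A i j
  specRadius_eq : A.specRadius = ρ
  pos : 0 < ρ
  isComponent : A.IsIrreducibleComponent S
  specRadius_inducedOn : (A.inducedOn S).specRadius = ρ
  unique : ∀ T : Finset V, A.IsIrreducibleComponent T → (A.inducedOn T).specRadius = ρ → T = S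

namespace IsDominantComponent

variable {A : Matrix V V ℝ} {ρ : ℝ} {S : Finset V}

theorem transpose (h : IsDominantComponent A ρ S) : IsDominantComponent Aᵀ ρ S where
  nonneg i j := h.nonneg j i
  specRadius_eq := (specRadius_transpose A).trans h.specRadius_eq
  pos := h.pos
  isComponent := (isIrreducibleComponent_transpose A S).2 h.isComponent
  specRadius_inducedOn := (specRadius_transpose (A.inducedOn S)).trans h.specRadius_inducedOn
  unique T hT hr := h.unique T ((isIrreducibleComponent_transpose A T).1 hT)
    ((specRadius_transpose (A.inducedOn T)).symm.trans hr)

theorem mem_of_hasWalk (h : IsDominantComponent A ρ S) {s t v : V} (hs : s ∈ S) (ht : t ∈ S)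
    (hsv : A.assocDigraph.HasWalk s v) (hvt : A.assocDigraph.HasWalk v t) : v ∈ S := by
  have hS := eq_strongClass h.isComponent hs
  rw [hS] at ht ⊢
  exact mem_strongClass.2 ⟨hsv, hvt.trans (mem_strongClass.1 ht).2⟩

/-- On a union of classes disjoint from the dominant component, there is no eigenvector for an
eigenvalue on the spectral circle. -/
theorem eq_zero_of_eigenvector_on (h : IsDominantComponent A ρ S) {T : Set V}
    (hT : ∀ v ∈ T, ∀ w, A.assocDigraph.HasWalk v w → A.assocDigraph.HasWalk w v → w ∈ T)
    (hTS : ∀ v ∈ T, v ∉ S) {z : ℂ} (hz : ‖z‖ = ρ) {x : V → ℂ} (hx : ∀ v ∉ T, x v = 0)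
    (hxz : ∀ v ∈ T, (A.complexify *ᵥ x) v = z * x v) : x = 0 := by
  classical
  by_contra hne
  obtain ⟨v₁, hv₁⟩ := Function.ne_iff.1 hne
  let reach : V → Finset V := fun v => Finset.univ.filter fun w => A.assocDigraph.HasWalk v w
  -- By minimality of the reachable set, every support vertex reachable from `v` leads back to `v`.
  -- Hence `x` restricts to an eigenvector on the class of `v`, which then has spectral radius `ρ`
  -- and must be `S`.
  obtain ⟨v, hv, hmin⟩ := Finset.exists_min_image (Finset.univ.filter fun v => x v ≠ 0)
    (fun v => (reach v).card) ⟨v₁, by simpa using hv₁⟩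
  have hxv : x v ≠ 0 := by simpa using hv
  have hback : ∀ w, x w ≠ 0 → A.assocDigraph.HasWalk v w → A.assocDigraph.HasWalk w v := by
    intro w hw hvw
    have hsub : reach w ⊆ reach v := fun u hu => by
      simp only [reach, Finset.mem_filter, Finset.mem_univ, true_and] at hu ⊢
      exact hvw.trans hu
    have heq := Finset.eq_of_subset_of_card_le hsub (hmin w (by simpa using hw))
    have : v ∈ reach v := by
      simp only [reach, Finset.mem_filter, Finset.mem_univ, true_and]
      exact Relation.ReflTransGen.refl
    rw [← heq] at this
    simpa [reach] using this
  have hvT : v ∈ T := by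
    by_contra hc
    exact hxv (hx v hc)
  set C := strongClass A v
  have hvC : v ∈ C := self_mem_strongClass A v
  have hCeig : (A.inducedOn C).complexify *ᵥ (fun j : C => x j) = z • fun j : C => x j := by
    funext i
    obtain ⟨h1, h2⟩ := mem_strongClass.1 i.2
    have hij : ∀ j ∉ C, A.complexify i j * x j = 0 := by
      intro j hj
      by_contra hc
      obtain ⟨hc1, hc2⟩ := mul_ne_zero_iff.1 hc
      have hadj : A i j ≠ 0 := fun h0 => hc1 (by simp [Matrix.complexify, h0])
      have hvj : A.assocDigraph.HasWalk v j := h1.tail hadj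
      exact hj (mem_strongClass.2 ⟨hvj, hback j hc2 hvj⟩)
    exact (mulVec_eq_submatrix_mulVec A.complexify i hij).symm.trans
      (hxz i (hT v hvT i h1 h2))
  have hle : ρ ≤ (A.inducedOn C).specRadius := hz ▸ norm_le_toReal_spectralRadius
    (Function.ne_iff.2 ⟨⟨v, hvC⟩, hxv⟩) hCeig
  have hCS := h.unique C (isIrreducibleComponent_strongClass A v)
    (le_antisymm (h.specRadius_eq ▸ specRadius_inducedOn_le h.nonneg ⟨v, hvC⟩) hle)
  exact hTS v hvT (hCS ▸ hvC)

theorem eq_zero_of_eigenvector (h : IsDominantComponent A ρ S) {z : ℂ} (hz : ‖z‖ = ρ) {x : V → ℂ}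
    (hxz : A.complexify *ᵥ x = z • x) (hx : ∀ v ∈ S, x v = 0) : x = 0 :=
  h.eq_zero_of_eigenvector_on (T := {v | v ∉ S})
    (fun _ hv _ hvw hwv hw => hv (h.mem_of_hasWalk hw hw hwv hvw)) (fun _ hv => hv) hz
    (fun v hv => hx v (not_not.1 hv)) fun v _ => congrFun hxz v

/-- No arc leaves the set of vertices that cannot reach `S`, so `x` cut off to this set still
satisfies the eigenvector equation there. -/
theorem apply_eq_zero_of_not_reach (h : IsDominantComponent A ρ S) {z : ℂ} (hz : ‖z‖ = ρ)
    {x : V → ℂ} (hxz : A.complexify *ᵥ x = z • x) {v : V}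
    (hv : ¬ ∃ s ∈ S, A.assocDigraph.HasWalk v s) : x v = 0 := by
  classical
  set T : Set V := {v | ¬ ∃ s ∈ S, A.assocDigraph.HasWalk v s}
  have h0 := h.eq_zero_of_eigenvector_on (T := T) (x := fun v => if v ∈ T then x v else 0)
    (fun v hv w hvw _ ⟨s, hs, hws⟩ => hv ⟨s, hs, hvw.trans hws⟩)
    (fun v hv hvS => hv ⟨v, hvS, .refl⟩) hz (fun v hv => if_neg hv) fun v hv => by
      rw [if_pos hv]
      refine Eq.trans (Finset.sum_congr rfl fun j _ => ?_) (congrFun hxz v)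
      by_cases hj : j ∈ T
      · simp [hj]
      · obtain ⟨s, hs, hjs⟩ := not_not.1 hj
        have hvj : A v j = 0 := by
          by_contra hc
          exact hv ⟨s, hs, hjs.head hc⟩
        simp [Matrix.complexify, hvj]
  have h1 := congrFun h0 v
  rwa [if_pos (show v ∈ T from hv)] at h1

/-- An arc leaving `S` ends at a vertex that cannot return to `S`, where `x` vanishes; such arcs
contribute nothing. -/
theorem restrict_eigenvector (h : IsDominantComponent A ρ S) {z : ℂ} (hz : ‖z‖ = ρ)
    {x : V → ℂ} (hxz : A.complexify *ᵥ x = z • x) :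
    (A.inducedOn S).complexify *ᵥ (fun j : S => x j) = z • fun j : S => x j := by
  funext i
  refine (mulVec_eq_submatrix_mulVec A.complexify i fun j hj => ?_).symm.trans (congrFun hxz i)
  by_contra hc
  obtain ⟨hc1, hc2⟩ := mul_ne_zero_iff.1 hc
  have hadj : A i j ≠ 0 := fun h0 => hc1 (by simp [Matrix.complexify, h0])
  obtain ⟨s, hs, hjs⟩ : ∃ s ∈ S, A.assocDigraph.HasWalk j s := by
    by_contra hn
    exact hc2 (h.apply_eq_zero_of_not_reach hz hxz hn)
  exact hj (h.mem_of_hasWalk i.2 hs (.single hadj) hjs)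

theorem restrict_ne_zero (h : IsDominantComponent A ρ S) {z : ℂ} (hz : ‖z‖ = ρ)
    {x : V → ℂ} (hx : x ≠ 0) (hxz : A.complexify *ᵥ x = z • x) : (fun j : S => x j) ≠ 0 :=
  fun h0 => hx (h.eq_zero_of_eigenvector hz hxz fun v hv => congrFun h0 ⟨v, hv⟩)

theorem norm_ofReal (h : IsDominantComponent A ρ S) : ‖(ρ : ℂ)‖ = ρ := by
  rw [Complex.norm_real, Real.norm_of_nonneg h.pos.le]

theorem eq_of_norm_eq (h : IsDominantComponent A ρ S)
    (haper : (A.inducedOn S).assocDigraph.IsAperiodic) {z : ℂ} (hz : ‖z‖ = ρ)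
    {x : V → ℂ} (hx : x ≠ 0) (hxz : A.complexify *ᵥ x = z • x) : z = ρ := by
  have hr := h.specRadius_inducedOn
  rw [← hr]
  exact eq_specRadius_of_aperiodic (A := A.inducedOn S) (fun i j => h.nonneg i j) h.isComponent.prop.2 haper
    (h.pos.trans_eq hr.symm) (h.restrict_ne_zero hz hx hxz) (h.restrict_eigenvector hz hxz) (hz.trans hr.symm)

theorem eq_smul (h : IsDominantComponent A ρ S) {x u : V → ℂ} (hu : u ≠ 0)
    (huz : A.complexify *ᵥ u = (ρ : ℂ) • u) (hxz : A.complexify *ᵥ x = (ρ : ℂ) • x) :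
    ∃ c : ℂ, x = c • u := by
  have hr := h.specRadius_inducedOn
  have hρ := h.norm_ofReal
  have hus := h.restrict_eigenvector hρ huz
  have hxs := h.restrict_eigenvector hρ hxz
  have hu0 := (arg_propagate (A := A.inducedOn S) (fun i j => h.nonneg i j) h.isComponent.prop.2
    (h.restrict_ne_zero hρ hu huz) hus (hρ.trans hr.symm)).1
  rw [← hr] at hus hxs
  obtain ⟨c, hc⟩ := eq_smul_of_irreducible (A := A.inducedOn S) (fun i j => h.nonneg i j)
    h.isComponent.prop.2 hu0 hus hxs
  refine ⟨c, sub_eq_zero.1 (h.eq_zero_of_eigenvector hρ ?_ fun v hv => ?_)⟩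
  · rw [Matrix.mulVec_sub, Matrix.mulVec_smul, hxz, huz, smul_sub, smul_comm]
  · have := congrFun hc ⟨v, hv⟩
    simpa [sub_eq_zero] using this

/-! ### Existence of normalized eigenvectors -/

/-- There is an eigenvector that is positive on the dominant component and vanishes at the
vertices from which the component cannot be reached. -/
theorem exists_eigenvector (h : IsDominantComponent A ρ S) :
    ∃ (x : V → ℂ) (y : V → ℝ), A.complexify *ᵥ x = (ρ : ℂ) • x ∧ (∀ v ∈ S, x v = y v ∧ 0 < y v) ∧
      ∀ v, (¬ ∃ s ∈ S, A.assocDigraph.HasWalk v s) → x v = 0 := by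
  classical
  have hr := h.specRadius_inducedOn
  have : Nonempty S := h.isComponent.prop.1.to_subtype
  obtain ⟨y, hy, hyA⟩ := exists_pos_eigenvector (A := A.inducedOn S) (fun i j => h.nonneg i j)
    h.isComponent.prop.2
  rw [hr] at hyA
  set T : Set V := {v | v ∉ S ∧ ∃ s ∈ S, A.assocDigraph.HasWalk v s} with hT
  -- Solving `L x = Y` imposes the eigenvector equation on `T`, the Perron vector on `S`, and zero
  -- elsewhere. Injectivity of `L` gives solvability in finite dimension.
  let L : (V → ℂ) →ₗ[ℂ] (V → ℂ) :=
    { toFun := fun x v => if v ∈ T then (A.complexify *ᵥ x) v - ρ * x v else x v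
      map_add' := fun x x' => by
        funext v
        simp only [Matrix.mulVec_add, Pi.add_apply]
        split_ifs <;> ring
      map_smul' := fun c x => by
        funext v
        simp only [Matrix.mulVec_smul, Pi.smul_apply, smul_eq_mul, RingHom.id_apply]
        split_ifs <;> ring }
  have hinj : Function.Injective L := by
    refine (injective_iff_map_eq_zero L).2 fun x hx => ?_
    refine h.eq_zero_of_eigenvector_on (T := T) ?_ (fun v hv => hv.1) h.norm_ofReal
      (fun v hv => ?_) fun v hv => ?_
    · rintro v ⟨hv, s, hs, hvs⟩ w hvw hwv
      exact ⟨fun hw => hv (h.mem_of_hasWalk hw hw hwv hvw), s, hs, hwv.trans hvs⟩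
    · have h1 : (if v ∈ T then (A.complexify *ᵥ x) v - ρ * x v else x v) = 0 := congrFun hx v
      rwa [if_neg hv] at h1
    · have h1 : (if v ∈ T then (A.complexify *ᵥ x) v - ρ * x v else x v) = 0 := congrFun hx v
      rwa [if_pos hv, sub_eq_zero] at h1
  set Y : V → ℝ := fun v => if hv : v ∈ S then y ⟨v, hv⟩ else 0 with hY
  obtain ⟨x, hx⟩ := LinearMap.injective_iff_surjective.1 hinj fun v => (Y v : ℂ)
  have hx' : ∀ v, (if v ∈ T then (A.complexify *ᵥ x) v - ρ * x v else x v) = Y v := congrFun hx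
  have hYS : ∀ v ∉ S, Y v = 0 := fun v hv => dif_neg hv
  have hxS : ∀ v ∈ S, x v = Y v := fun v hv => by
    have h1 := hx' v
    rwa [if_neg fun hc => hc.1 hv] at h1
  have hxW : ∀ v, (¬ ∃ s ∈ S, A.assocDigraph.HasWalk v s) → x v = 0 := fun v hv => by
    have h1 := hx' v
    have hvS : v ∉ S := fun hc => hv ⟨v, hc, .refl⟩
    rwa [if_neg fun hc => hv hc.2, hYS v hvS, Complex.ofReal_zero] at h1
  refine ⟨x, Y, funext fun v => ?_, fun v hv => ⟨hxS v hv, by simpa [hY, hv] using hy ⟨v, hv⟩⟩,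
    hxW⟩
  rw [Pi.smul_apply, smul_eq_mul]
  by_cases hvS : v ∈ S
  · have h1 := mulVec_eq_submatrix_mulVec A.complexify (x := x) ⟨v, hvS⟩ fun j hj => by
      by_contra hc
      obtain ⟨hc1, hc2⟩ := mul_ne_zero_iff.1 hc
      have hadj : A v j ≠ 0 := fun h0 => hc1 (by simp [Matrix.complexify, h0])
      refine hc2 (hxW j fun ⟨s, hs, hjs⟩ => hj (h.mem_of_hasWalk hvS hs (.single hadj) hjs))
    have h2 : (fun j : S => x j) = fun j : S => (y j : ℂ) := funext fun j => by
      rw [hxS j j.2]; simp [hY]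
    have h3 := complexify_mulVec (A.inducedOn S) y ⟨v, hvS⟩
    rw [hyA] at h3
    rw [h2] at h1
    rw [show (A.complexify *ᵥ x) v = _ from h1.trans h3, hxS v hvS]
    simp [hY, hvS]
  · by_cases hv : ∃ s ∈ S, A.assocDigraph.HasWalk v s
    · have h1 := hx' v
      rw [if_pos ⟨hvS, hv⟩, hYS v hvS, Complex.ofReal_zero] at h1
      exact sub_eq_zero.1 h1
    · rw [hxW v hv, mul_zero]
      refine Finset.sum_eq_zero fun j _ => ?_
      by_cases hadj : A v j = 0
      · simp [Matrix.complexify, hadj]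
      · rw [hxW j fun ⟨s, hs, hjs⟩ => hv ⟨s, hs, hjs.head hadj⟩, mul_zero]

theorem exists_normalized_eigenvectors (h : IsDominantComponent A ρ S) :
    ∃ vL vR : V → ℂ, A.complexify.IsLeftEigenvector (ρ : ℂ) vL ∧
      A.complexify.IsRightEigenvector (ρ : ℂ) vR ∧ vL ⬝ᵥ vR = 1 := by
  obtain ⟨x, y, hx, hxy, hx0⟩ := h.exists_eigenvector
  obtain ⟨x', y', hx', hxy', hx0'⟩ := h.transpose.exists_eigenvector
  have hleft : x' ᵥ* A.complexify = (ρ : ℂ) • x' := by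
    rw [← hx', ← Matrix.mulVec_transpose]
    rfl
  -- A vertex where both vectors are nonzero is reachable from `S` and reaches `S`, hence lies in
  -- `S`.
  have hdot : x' ⬝ᵥ x = ((∑ v ∈ S, y' v * y v : ℝ) : ℂ) := by
    push_cast
    rw [dotProduct, ← Finset.sum_subset (Finset.subset_univ S) fun v _ hv => ?_]
    · exact Finset.sum_congr rfl fun v hv => by rw [(hxy v hv).1, (hxy' v hv).1]
    · by_contra hc
      obtain ⟨hc1, hc2⟩ := mul_ne_zero_iff.1 hc
      obtain ⟨s, hs, hvs⟩ := not_not.1 fun hn => hc2 (hx0 v hn)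
      obtain ⟨t, ht, hvt⟩ := not_not.1 fun hn => hc1 (hx0' v hn)
      exact hv (h.mem_of_hasWalk ht hs ((hasWalk_transpose A v t).1 hvt) hvs)
  have hne : x' ⬝ᵥ x ≠ 0 := by
    rw [hdot]
    exact_mod_cast (Finset.sum_pos (fun v hv => mul_pos (hxy' v hv).2 (hxy v hv).2)
      h.isComponent.prop.1).ne'
  refine ⟨(x' ⬝ᵥ x)⁻¹ • x', x, ⟨?_, ?_⟩, ⟨?_, hx⟩, ?_⟩
  · refine smul_ne_zero (inv_ne_zero hne) ?_
    rintro rfl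
    exact hne (zero_dotProduct _)
  · rw [Matrix.smul_vecMul, hleft, smul_comm]
  · rintro rfl
    exact hne (dotProduct_zero _)
  · rw [smul_dotProduct, smul_eq_mul, inv_mul_cancel₀ hne]

/-! ### Deflation and the asymptotic formula -/

/-- Removing the dominant eigenvalue strictly decreases the spectral radius. -/
theorem spectralRadius_deflation_lt (h : IsDominantComponent A ρ S)
    (haper : (A.inducedOn S).assocDigraph.IsAperiodic) {vL vR : V → ℂ}
    (hL : A.complexify.IsLeftEigenvector (ρ : ℂ) vL)
    (hR : A.complexify.IsRightEigenvector (ρ : ℂ) vR) (hLR : vL ⬝ᵥ vR = 1) :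
    (spectralRadius ℂ (A.complexify - (ρ : ℂ) • vecMulVec vR vL)).toReal < ρ := by
  refine toReal_spectralRadius_lt h.pos fun z x hx hxz => ?_
  by_contra! hge
  have hz0 : z ≠ 0 := norm_pos_iff.1 (h.pos.trans_le hge)
  rw [Matrix.sub_mulVec, Matrix.smul_mulVec, Matrix.vecMulVec_mulVec] at hxz
  -- The deflated matrix is annihilated by `vL` on the left, so pairing gives `z * (vL ⬝ᵥ x) = 0`.
  -- Thus `x` is an eigenvector of `A` itself, hence a multiple of `vR`, and the pairing makes it
  -- zero.
  have hdot : vL ⬝ᵥ x = 0 := by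
    have h1 := congrArg (fun w => vL ⬝ᵥ w) hxz
    simp only [dotProduct_sub, dotProduct_smul, Matrix.dotProduct_mulVec, hL.2, smul_dotProduct,
      smul_eq_mul, hLR, op_smul_eq_smul, mul_one, sub_self] at h1
    exact (mul_eq_zero.1 h1.symm).resolve_left hz0
  rw [hdot] at hxz
  simp only [MulOpposite.op_zero, zero_smul, smul_zero, sub_zero] at hxz
  have hle : ‖z‖ ≤ ρ := h.specRadius_eq ▸ norm_le_toReal_spectralRadius hx hxz
  have hzρ := h.eq_of_norm_eq haper (le_antisymm hle hge) hx hxz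
  rw [hzρ] at hxz
  obtain ⟨c, rfl⟩ := h.eq_smul hR.1 hR.2 hxz
  rw [dotProduct_smul, hLR, smul_eq_mul, mul_one] at hdot
  exact hx (by rw [hdot, zero_smul])

/-- The bilinear forms of the powers of `A` are asymptotically `ρ ^ n` times a constant, with an
exponentially small relative error. -/
theorem exists_asymptotic (h : IsDominantComponent A ρ S)
    (haper : (A.inducedOn S).assocDigraph.IsAperiodic) {vL vR : V → ℂ}
    (hL : A.complexify.IsLeftEigenvector (ρ : ℂ) vL)
    (hR : A.complexify.IsRightEigenvector (ρ : ℂ) vR) (hLR : vL ⬝ᵥ vR = 1) (wL wR : V → ℂ) :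
    ∃ C ε : ℝ, 0 < C ∧ 0 < ε ∧ ε < 1 ∧ ∃ p : ℕ → ℂ,
      (∀ n : ℕ, wL ⬝ᵥ (A.complexify ^ n) *ᵥ wR =
        ((wL ⬝ᵥ vR) * (vL ⬝ᵥ wR) + p n) * (ρ : ℂ) ^ n) ∧
      ∀ n : ℕ, ‖p n‖ < C * (1 - ε) ^ n := by
  obtain ⟨s, hs, hsρ⟩ := exists_between (h.spectralRadius_deflation_lt haper hL hR hLR)
  have hs0 : 0 < s := lt_of_le_of_lt ENNReal.toReal_nonneg hs
  set B := A.complexify - (ρ : ℂ) • vecMulVec vR vL with hB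
  -- The part of `wR` killed by `vL`; on it the powers of `A` and `B` agree.
  set z := wR - (vL ⬝ᵥ wR) • vR with hz
  obtain ⟨C, hC, hb⟩ := exists_norm_dotProduct_pow_mulVec_lt hs wL z
  have hLz : vL ⬝ᵥ z = 0 := by
    rw [hz, dotProduct_sub, dotProduct_smul, hLR, smul_eq_mul, mul_one, sub_self]
  have hLA : ∀ n : ℕ, vL ⬝ᵥ (A.complexify ^ n) *ᵥ z = 0 := by
    intro n
    induction n with
    | zero => simpa using hLz
    | succ n ih =>
      rw [pow_succ', ← Matrix.mulVec_mulVec, Matrix.dotProduct_mulVec, hL.2, smul_dotProduct, ih,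
        smul_zero]
  have hBA : ∀ n : ℕ, (B ^ n) *ᵥ z = (A.complexify ^ n) *ᵥ z := by
    intro n
    induction n with
    | zero => simp
    | succ n ih =>
      rw [pow_succ', ← Matrix.mulVec_mulVec, ih, hB, Matrix.sub_mulVec, Matrix.smul_mulVec,
        Matrix.vecMulVec_mulVec, hLA n, Matrix.mulVec_mulVec, ← pow_succ']
      simp
  have hRA : ∀ n : ℕ, (A.complexify ^ n) *ᵥ vR = (ρ : ℂ) ^ n • vR := by
    intro n
    induction n with
    | zero => simp
    | succ n ih =>
      rw [pow_succ, ← Matrix.mulVec_mulVec, hR.2, Matrix.mulVec_smul, ih, smul_smul, pow_succ']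
  have hρn : ∀ n : ℕ, (ρ : ℂ) ^ n ≠ 0 := fun n => pow_ne_zero n (by exact_mod_cast h.pos.ne')
  -- The relative error decays like `(s / ρ) ^ n`, which dictates `ε = 1 - s / ρ`.
  refine ⟨C, 1 - s / ρ, hC, sub_pos.2 ((div_lt_one h.pos).2 hsρ),
    sub_lt_self 1 (div_pos hs0 h.pos), fun n => (wL ⬝ᵥ (B ^ n) *ᵥ z) / (ρ : ℂ) ^ n,
    fun n => ?_, fun n => ?_⟩
  · have hw : wR = (vL ⬝ᵥ wR) • vR + z := by rw [hz]; abel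
    conv_lhs => rw [hw]
    rw [Matrix.mulVec_add, Matrix.mulVec_smul, hRA, dotProduct_add, dotProduct_smul,
      dotProduct_smul, ← hBA n, add_mul, div_mul_cancel₀ _ (hρn n), smul_eq_mul, smul_eq_mul]
    ring
  · rw [norm_div, norm_pow, Complex.norm_real, Real.norm_of_nonneg h.pos.le, sub_sub_cancel,
      div_pow, ← mul_div_assoc]
    exact div_lt_div_of_pos_right (hb n) (pow_pos h.pos n)

end IsDominantComponent

end PerronFrobenius

theorem mainTheorem11 {V : Type*} [Fintype V] [DecidableEq V] (A : Matrix V V ℝ)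
    (hA : ∀ i j, 0 ≤ A i j) (ρ : ℝ) (hρ : A.specRadius = ρ) (hρ_pos : 0 < ρ)
    (D₁ : Finset V) (hD₁ : A.IsIrreducibleComponent D₁)
    (hD₁_rad : (A.inducedOn D₁).specRadius = ρ)
    (hD₁_unique : ∀ S : Finset V, A.IsIrreducibleComponent S →
      (A.inducedOn S).specRadius = ρ → S = D₁)
    (hD₁_aper : (A.inducedOn D₁).assocDigraph.IsAperiodic) :
    (∃ vL vR : V → ℂ, A.complexify.IsLeftEigenvector (ρ : ℂ) vL ∧
      A.complexify.IsRightEigenvector (ρ : ℂ) vR ∧ vL ⬝ᵥ vR = 1) ∧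
    ∀ vL vR : V → ℂ, A.complexify.IsLeftEigenvector (ρ : ℂ) vL →
      A.complexify.IsRightEigenvector (ρ : ℂ) vR → vL ⬝ᵥ vR = 1 →
      ∀ wL wR : V → ℂ, ∃ C ε : ℝ, 0 < C ∧ 0 < ε ∧ ε < 1 ∧ ∃ p : ℕ → ℂ,
        (∀ n : ℕ, wL ⬝ᵥ (A.complexify ^ n).mulVec wR =
          ((wL ⬝ᵥ vR) * (vL ⬝ᵥ wR) + p n) * (ρ : ℂ) ^ n) ∧
        ∀ n : ℕ, ‖p n‖ < C * (1 - ε) ^ n := by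
  have h : PerronFrobenius.IsDominantComponent A ρ D₁ :=
    ⟨hA, hρ, hρ_pos, hD₁, hD₁_rad, hD₁_unique⟩
  exact ⟨h.exists_normalized_eigenvectors, fun _ _ hL hR hLR wL wR =>
    h.exists_asymptotic hD₁_aper hL hR hLR wL wR⟩
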